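/- For $A,B,C\in\mathrm{SL}(3,\mathbb C)$ with $CBA=I$, define the shape invariants $$\sigma_+(A,B,C)=\operatorname{tr}(A^{-1}B)-\operatorname{tr}(A^{-1})\operatorname{tr}(B),\qquad \sigma_-(A,B,C)=\operatorname{tr}(B^{-1}A)-\operatorname{tr}(B^{-1})\operatorname{tr}(A),$$ and write $[A,B]=ABA^{-1}B^{-1}$. Let $\Phi_*:\mathrm{SL}(2,\mathbb C)\to\mathrm{SL}(3,\mathbb C)$ be the irreducible representation $$\Phi_*\begin{pmatrix} a&b\\ c&d\end{pmatrix}=\begin{pmatrix} a^2&-\sqrt2\,ab&-b^2\\ -\sqrt2\,ac&ad+bc&\sqrt2\,bd\\ -c^2&\sqrt2\,cd&d^2\end{pmatrix}.$$ A subgroup of $\mathrm{SL}(3,\mathbb C)$ is called reducible if it leaves invariant a complex linear subspace of $\mathbb C^3$ other than $0$ and $\mathbb C^3$. Suppose that $A,B,C\in\mathrm{SL}(3,\mathbb C)$ satisfy $CBA=I$ and $$\operatorname{tr}(A)=\operatorname{tr}(A^{-1}),\quad \operatorname{tr}(B)=\operatorname{tr}(B^{-1}),\quad \operatorname{tr}(C)=\operatorname{tr}(C^{-1}),$$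 $$\sigma_+(A,B,C)=\sigma_-(A,B,C),\quad \operatorname{tr}[A,B]=\operatorname{tr}\bigl([A,B]^{-1}\bigr).$$ Then the subgroup $\langle A,B,C\rangle$ of $\mathrm{SL}(3,\mathbb C)$ is reducible, or there is $D\in\mathrm{SL}(3,\mathbb C)$ such that $D\langle A,B,C\rangle D^{-1}$ is contained in the image of $\Phi_*$. -/

import Mathlib

open scoped Matrix MatrixGroups

namespace ShapeInvariants

noncomputable section

/-- The trace of an element of `SL(n, ℂ)`. -/
def tr {n : ℕ} (A : SL(n, ℂ)) : ℂ :=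
  (A : Matrix (Fin n) (Fin n) ℂ).trace

/-- The shape invariant `σ₊ = tr(A⁻¹B) - tr(A⁻¹) tr(B)` of a triple `A, B, C` with `CBA = I`
(`C` is determined by `A` and `B`). -/
def shapePlus (A B _C : SL(3, ℂ)) : ℂ :=
  tr (A⁻¹ * B) - tr A⁻¹ * tr B

/-- The shape invariant `σ₋ = tr(B⁻¹A) - tr(B⁻¹) tr(A)` of a triple `A, B, C` with `CBA = I`
(`C` is determined by `A` and `B`). -/
def shapeMinus (A B _C : SL(3, ℂ)) : ℂ :=
  tr (B⁻¹ * A) - tr B⁻¹ * tr A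

/-- A subgroup `Γ` of `SL(3, ℂ)` is reducible if its action on column vectors leaves invariant
a complex linear subspace of `ℂ³` other than `0` and `ℂ³`. -/
def IsReducible (Γ : Subgroup SL(3, ℂ)) : Prop :=
  ∃ W : Submodule ℂ (Fin 3 → ℂ), W ≠ ⊥ ∧ W ≠ ⊤ ∧
    ∀ g ∈ Γ, ∀ v ∈ W, (g : Matrix (Fin 3) (Fin 3) ℂ) *ᵥ v ∈ W

/-- The matrix of `Φ_*(M)`. -/
def phiStarMatrix (M : Matrix (Fin 2) (Fin 2) ℂ) : Matrix (Fin 3) (Fin 3) ℂ :=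
  let s : ℂ := (Real.sqrt 2 : ℝ)
  let a := M 0 0
  let b := M 0 1
  let c := M 1 0
  let d := M 1 1
  !![a ^ 2,      -s * a * b,     -b ^ 2;
     -s * a * c,  a * d + b * c,  s * b * d;
     -c ^ 2,      s * c * d,      d ^ 2]

theorem sqrt_two_mul_self : ((Real.sqrt 2 : ℝ) : ℂ) * ((Real.sqrt 2 : ℝ) : ℂ) = 2 := by
  rw [← Complex.ofReal_mul, Real.mul_self_sqrt (by norm_num)]
  norm_num

theorem phiStarMatrix_det (M : SL(2, ℂ)) :
    (phiStarMatrix (M : Matrix (Fin 2) (Fin 2) ℂ)).det = 1 := by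
  have hd := M.det_coe
  rw [Matrix.det_fin_two] at hd
  have hs := sqrt_two_mul_self
  simp only [phiStarMatrix, Matrix.det_fin_three, Matrix.of_apply, Matrix.cons_val', Matrix.cons_val]
  generalize ((Real.sqrt 2 : ℝ) : ℂ) = s at *
  generalize (M : Matrix (Fin 2) (Fin 2) ℂ) 0 0 = a at *
  generalize (M : Matrix (Fin 2) (Fin 2) ℂ) 0 1 = b at *
  generalize (M : Matrix (Fin 2) (Fin 2) ℂ) 1 0 = c at *
  generalize (M : Matrix (Fin 2) (Fin 2) ℂ) 1 1 = d at *
  have h3 : (a * d - b * c) ^ 3 = 1 := by rw [hd]; ring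
  linear_combination h3 + (-2 * a ^ 2 * b * c * d ^ 2 + 2 * a * b ^ 2 * c ^ 2 * d) * hs

theorem phiStarMatrix_mul (M N : Matrix (Fin 2) (Fin 2) ℂ) :
    phiStarMatrix (M * N) = phiStarMatrix M * phiStarMatrix N := by
  have hs := sqrt_two_mul_self
  ext i j
  fin_cases i <;> fin_cases j <;>
    simp [phiStarMatrix, Matrix.mul_apply, Fin.sum_univ_succ] <;>
    generalize ((Real.sqrt 2 : ℝ) : ℂ) = s at * <;>
    grind

theorem phiStarMatrix_one : phiStarMatrix 1 = 1 := by
  ext i j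
  fin_cases i <;> fin_cases j <;> simp [phiStarMatrix]

/-- The irreducible representation `Φ_* : SL(2, ℂ) → SL(3, ℂ)`. -/
def phiStar : SL(2, ℂ) →* SL(3, ℂ) where
  toFun M := ⟨phiStarMatrix (M : Matrix (Fin 2) (Fin 2) ℂ), phiStarMatrix_det M⟩
  map_one' := Subtype.ext (by simpa using phiStarMatrix_one)
  map_mul' M N := Subtype.ext (phiStarMatrix_mul M N)

end

end ShapeInvariants

/-! View the pair `A`, `B` as a representation of the free group on two letters. The hypotheses say
that ten traces are unchanged by inversion: those of `A`, `B`, their inverses, the four products of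
`A`, `A⁻¹` with `B`, `B⁻¹`, and the commutator and its inverse. Polarised Cayley–Hamilton shows that
these ten determine the trace of every word (`wordTrace_eq_of_ten`), so the representation and its
contragredient have the same character.

If the group is irreducible, both representations span the matrix algebra by Burnside's theorem.
Nondegeneracy of the trace form and Skolem–Noether then make them conjugate
(`exists_conj_of_trace_eq`). The intertwiner is an invariant bilinear form; Schur's lemma makes it
symmetric or alternating, and odd dimension leaves only symmetric
(`exists_invariant_symmetric_form`). Over ℂ it is congruent to `y² + 2xz`, whose special orthogonal
group is the image of `Φ_*`. -/

namespace ShapeInvariants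

/-! ### Trace identities for words in two matrices -/

section WordTraces

variable {R : Type*} [CommRing R]

/-- This is the derivative of the Cayley–Hamilton identity at `M` in the direction `X`, with `M²`
eliminated in favour of the adjugate. -/
theorem mul_mul_self_eq_adjugate (M X : Matrix (Fin 3) (Fin 3) R) :
    M * X * M = -(M.adjugate * X) - X * M.adjugate + M.adjugate.trace • X
      - (X.trace * M.adjugate.trace) • (1 : Matrix (Fin 3) (Fin 3) R) + X.trace • M.adjugate
      + (M * X).trace • M + (M.adjugate * X).trace • (1 : Matrix (Fin 3) (Fin 3) R) := by
  ext i j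
  fin_cases i <;> fin_cases j <;>
    simp [Matrix.mul_apply, Fin.sum_univ_three, Matrix.trace_fin_three] <;>
    simp [Matrix.adjugate_fin_three] <;>
    ring

/-- The polarised Cayley–Hamilton identity, in trace form. -/
theorem trace_mul_mul_mul (M : Matrix.SpecialLinearGroup (Fin 3) R)
    (X Y : Matrix (Fin 3) (Fin 3) R) :
    ((M : Matrix (Fin 3) (Fin 3) R) * X * M * Y).trace =
      -((M⁻¹ : Matrix.SpecialLinearGroup (Fin 3) R) * (X * Y) : Matrix (Fin 3) (Fin 3) R).trace
      - ((M⁻¹ : Matrix.SpecialLinearGroup (Fin 3) R) * (Y * X) : Matrix (Fin 3) (Fin 3) R).trace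
      + (M⁻¹ : Matrix.SpecialLinearGroup (Fin 3) R).1.trace * (X * Y).trace
      - X.trace * (M⁻¹ : Matrix.SpecialLinearGroup (Fin 3) R).1.trace * Y.trace
      + X.trace * ((M⁻¹ : Matrix.SpecialLinearGroup (Fin 3) R) * Y : Matrix (Fin 3) (Fin 3) R).trace
      + ((M : Matrix (Fin 3) (Fin 3) R) * X).trace * ((M : Matrix (Fin 3) (Fin 3) R) * Y).trace
      + ((M⁻¹ : Matrix.SpecialLinearGroup (Fin 3) R) * X : Matrix (Fin 3) (Fin 3) R).trace
        * Y.trace := by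
  have hrot : (X * (M.1.adjugate * Y)).trace = (M.1.adjugate * (Y * X)).trace := by
    rw [Matrix.trace_mul_comm, Matrix.mul_assoc]
  rw [mul_mul_self_eq_adjugate, Matrix.SpecialLinearGroup.coe_inv]
  simp only [add_mul, sub_mul, neg_mul, smul_mul_assoc, one_mul, Matrix.trace_add,
    Matrix.trace_sub, Matrix.trace_neg, Matrix.trace_smul, smul_eq_mul, Matrix.mul_assoc, hrot]

/-- The value of a letter, `(i, true)` standing for the `i`-th generator and `(i, false)` for
its inverse. -/
def letter {G : Type*} [Group G] (ρ : Bool → G) (x : Bool × Bool) : G :=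
  cond x.2 (ρ x.1) (ρ x.1)⁻¹

/-- The value of a word. -/
def word {G : Type*} [Group G] (ρ : Bool → G) (L : List (Bool × Bool)) : G :=
  (L.map (letter ρ)).prod

section

variable {G : Type*} [Group G] (ρ : Bool → G)

@[simp] theorem word_nil : word ρ [] = 1 := rfl

@[simp] theorem word_cons (x : Bool × Bool) (L : List (Bool × Bool)) :
    word ρ (x :: L) = letter ρ x * word ρ L := by
  simp [word]

@[simp] theorem word_append (L L' : List (Bool × Bool)) :
    word ρ (L ++ L') = word ρ L * word ρ L' := by
  simp [word]

theorem letter_not (x : Bool × Bool) : letter ρ (x.1, !x.2) = (letter ρ x)⁻¹ := by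
  rcases x with ⟨i, _ | _⟩ <;> simp [letter]

end

/-- The trace of the value of a word in two elements of `SL(3, R)`. -/
def wordTrace (ρ : Bool → Matrix.SpecialLinearGroup (Fin 3) R) (L : List (Bool × Bool)) : R :=
  (word ρ L).1.trace

theorem wordTrace_append_comm (ρ : Bool → Matrix.SpecialLinearGroup (Fin 3) R)
    (L L' : List (Bool × Bool)) : wordTrace ρ (L ++ L') = wordTrace ρ (L' ++ L) := by
  simp only [wordTrace, word_append, Matrix.SpecialLinearGroup.coe_mul]
  exact Matrix.trace_mul_comm _ _

/-- Every word on the right has fewer occurrences of the generator `x.1` than the word on the left,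
so this drives an induction on that number. -/
theorem wordTrace_repeat (ρ : Bool → Matrix.SpecialLinearGroup (Fin 3) R) (x : Bool × Bool)
    (X Y : List (Bool × Bool)) :
    wordTrace ρ (x :: (X ++ x :: Y)) =
      -wordTrace ρ ((x.1, !x.2) :: (X ++ Y)) - wordTrace ρ ((x.1, !x.2) :: (Y ++ X))
      + wordTrace ρ [(x.1, !x.2)] * wordTrace ρ (X ++ Y)
      - wordTrace ρ X * wordTrace ρ [(x.1, !x.2)] * wordTrace ρ Y
      + wordTrace ρ X * wordTrace ρ ((x.1, !x.2) :: Y)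
      + wordTrace ρ (x :: X) * wordTrace ρ (x :: Y)
      + wordTrace ρ ((x.1, !x.2) :: X) * wordTrace ρ Y := by
  have h := trace_mul_mul_mul (letter ρ x) (word ρ X).1 (word ρ Y).1
  simp only [wordTrace, word_append, word_cons, word_nil, letter_not, mul_one,
    Matrix.SpecialLinearGroup.coe_mul]
  rw [← h]
  simp only [Matrix.mul_assoc]

/-- A word in which only the second generator occurs lies in the span of `1, B, B⁻¹`, with
coefficients depending only on the traces of `B` and `B⁻¹`. -/
theorem exists_word_eq_of_forall_fst_eq_false
    (ρ ρ' : Bool → Matrix.SpecialLinearGroup (Fin 3) R)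
    (h₁ : wordTrace ρ [(false, true)] = wordTrace ρ' [(false, true)])
    (h₂ : wordTrace ρ [(false, false)] = wordTrace ρ' [(false, false)])
    (L : List (Bool × Bool)) (hL : ∀ x ∈ L, x.1 = false) :
    ∃ a b c : R, ∀ σ, σ = ρ ∨ σ = ρ' → (word σ L).1 =
      a • (1 : Matrix (Fin 3) (Fin 3) R) + b • (σ false).1 + c • ((σ false)⁻¹).1 := by
  induction L with
  | nil => exact ⟨1, 0, 0, fun σ _ => by simp⟩
  | cons x L ih =>
    obtain ⟨a, b, c, h⟩ := ih fun y hy => hL y (List.mem_cons_of_mem _ hy)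
    have hx := hL x List.mem_cons_self
    -- Cayley–Hamilton, as the case `X = 1`; it rewrites `B²` and `B⁻²` in the span of `1, B, B⁻¹`.
    have sq : ∀ M : Matrix.SpecialLinearGroup (Fin 3) R,
        M.1 * M.1 = M.1.trace • M.1 - (M⁻¹).1.trace • (1 : Matrix (Fin 3) (Fin 3) R)
          + (M⁻¹).1 := by
      intro M
      have h := mul_mul_self_eq_adjugate M.1 1
      rw [← Matrix.SpecialLinearGroup.coe_inv] at h
      simp only [mul_one, one_mul, Matrix.trace_one, Fintype.card_fin] at h
      rw [h]
      module
    have e₁ : ∀ M : Matrix.SpecialLinearGroup (Fin 3) R, M.1 * (M⁻¹).1 = 1 := fun M => by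
      rw [← Matrix.SpecialLinearGroup.coe_mul]; simp
    have e₂ : ∀ M : Matrix.SpecialLinearGroup (Fin 3) R, (M⁻¹).1 * M.1 = 1 := fun M => by
      rw [← Matrix.SpecialLinearGroup.coe_mul]; simp
    have ht : ∀ σ, σ = ρ ∨ σ = ρ' → (σ false).1.trace = wordTrace ρ [(false, true)] ∧
        ((σ false)⁻¹).1.trace = wordTrace ρ [(false, false)] := by
      rintro σ (rfl | rfl)
      · simp [wordTrace, letter]
      · rw [h₁, h₂]; simp [wordTrace, letter]
    set t := wordTrace ρ [(false, true)]
    set u := wordTrace ρ [(false, false)]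
    rcases x with ⟨_ | _, _ | _⟩
    · refine ⟨b - c * t, c, a + c * u, fun σ hσ => ?_⟩
      have hs := sq (σ false)⁻¹
      rw [inv_inv, (ht σ hσ).1, (ht σ hσ).2] at hs
      simp only [word_cons, letter, cond_false, Matrix.SpecialLinearGroup.coe_mul, h σ hσ,
        mul_add, mul_smul_comm, mul_one, e₂, hs]
      module
    · refine ⟨c - b * u, a + b * t, b, fun σ hσ => ?_⟩
      have hs := sq (σ false)
      rw [(ht σ hσ).1, (ht σ hσ).2] at hs
      simp only [word_cons, letter, cond_true, Matrix.SpecialLinearGroup.coe_mul, h σ hσ,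
        mul_add, mul_smul_comm, mul_one, e₁, hs]
      module
    · simp at hx
    · simp at hx

/-- The traces of all words in two elements of `SL(3, R)` are determined by the traces of ten
words. -/
theorem wordTrace_eq_of_ten (ρ ρ' : Bool → Matrix.SpecialLinearGroup (Fin 3) R)
    (hA : ∀ i, wordTrace ρ [(true, i)] = wordTrace ρ' [(true, i)])
    (hB : ∀ i, wordTrace ρ [(false, i)] = wordTrace ρ' [(false, i)])
    (hAB : ∀ i j, wordTrace ρ [(true, i), (false, j)] = wordTrace ρ' [(true, i), (false, j)])
    (hcomm : ∀ i, wordTrace ρ [(true, true), (false, i), (true, false), (false, !i)] =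
      wordTrace ρ' [(true, true), (false, i), (true, false), (false, !i)])
    (L : List (Bool × Bool)) : wordTrace ρ L = wordTrace ρ' L := by
  have h1 : wordTrace ρ [] = wordTrace ρ' [] := by simp [wordTrace]
  have span := exists_word_eq_of_forall_fst_eq_false ρ ρ' (hB true) (hB false)
  -- words with at most one occurrence of the first generator
  have base0 : ∀ X : List (Bool × Bool), (∀ y ∈ X, y.1 = false) →
      wordTrace ρ X = wordTrace ρ' X := by
    intro X hX
    obtain ⟨a, b, c, h⟩ := span X hX
    have k1 := hB true
    have k2 := hB false
    simp only [wordTrace, word_cons, word_nil, mul_one, letter, cond_true, cond_false] at k1 k2 ⊢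
    simp only [h ρ (Or.inl rfl), h ρ' (Or.inr rfl), Matrix.trace_add, Matrix.trace_smul, k1, k2]
  have base1 : ∀ (i : Bool) (X : List (Bool × Bool)), (∀ y ∈ X, y.1 = false) →
      wordTrace ρ ((true, i) :: X) = wordTrace ρ' ((true, i) :: X) := by
    intro i X hX
    obtain ⟨a, b, c, h⟩ := span X hX
    have k0 := hA i
    have k1 := hAB i true
    have k2 := hAB i false
    simp only [wordTrace, word_cons, word_nil, mul_one, Matrix.SpecialLinearGroup.coe_mul,
      h ρ (Or.inl rfl), h ρ' (Or.inr rfl), mul_add, mul_smul_comm, Matrix.trace_add,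
      Matrix.trace_smul] at k0 k1 k2 ⊢
    simp only [letter, cond_true, cond_false] at k0 k1 k2 ⊢
    rw [k0, k1, k2]
  have hABA : ∀ i j, wordTrace ρ [(true, true), (false, i), (true, false), (false, j)] =
      wordTrace ρ' [(true, true), (false, i), (true, false), (false, j)] := by
    intro i j
    by_cases hij : j = !i
    · rw [hij]; exact hcomm i
    -- Here the second generator repeats with the same sign, so the reduction applied to it leaves
    -- only words of length at most two.
    obtain rfl : j = i := by revert hij; revert i j; decide
    have cancel : ∀ σ : Bool → Matrix.SpecialLinearGroup (Fin 3) R, ∀ x k,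
        wordTrace σ [x, (true, k), (true, !k)] = wordTrace σ [x] := by
      rintro σ x (_ | _) <;> simp [wordTrace, letter]
    have cancel' : ∀ σ : Bool → Matrix.SpecialLinearGroup (Fin 3) R,
        wordTrace σ [(true, false), (true, true)] = wordTrace σ [] := by
      rintro σ; simp [wordTrace, letter]
    have swap : ∀ x y, wordTrace ρ [y, x] = wordTrace ρ' [y, x] →
        wordTrace ρ [x, y] = wordTrace ρ' [x, y] := by
      intro x y h
      rw [← List.singleton_append, wordTrace_append_comm, wordTrace_append_comm ρ']
      exact h
    have rot : ∀ σ : Bool → Matrix.SpecialLinearGroup (Fin 3) R,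
        wordTrace σ [(true, true), (false, j), (true, false), (false, j)] =
        wordTrace σ ((false, j) :: ([(true, false)] ++ (false, j) :: [(true, true)])) :=
      fun σ => wordTrace_append_comm σ [(true, true)] _
    rw [rot, rot, wordTrace_repeat, wordTrace_repeat]
    simp only [List.singleton_append, cancel', h1]
    have c1 := fun σ : Bool → Matrix.SpecialLinearGroup (Fin 3) R => cancel σ (false, !j) true
    have c2 := fun σ : Bool → Matrix.SpecialLinearGroup (Fin 3) R => cancel σ (false, !j) false
    simp only [Bool.not_true, Bool.not_false] at c1 c2
    rw [c1, c2, c1, c2, hA true, hA false, hB, swap _ _ (hAB true (!j)),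
      swap _ _ (hAB false j), swap _ _ (hAB true j), swap _ _ (hAB false (!j))]
  have base2 : ∀ X Y : List (Bool × Bool), (∀ y ∈ X, y.1 = false) → (∀ y ∈ Y, y.1 = false) →
      wordTrace ρ ((true, true) :: (X ++ (true, false) :: Y)) =
        wordTrace ρ' ((true, true) :: (X ++ (true, false) :: Y)) := by
    intro X Y hX hY
    obtain ⟨a, b, c, h⟩ := span X hX
    obtain ⟨a', b', c', h'⟩ := span Y hY
    have k1 := hB true
    have k2 := hB false
    have k3 := hABA true true
    have k4 := hABA true false
    have k5 := hABA false true
    have k6 := hABA false false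
    have expand : ∀ σ, σ = ρ ∨ σ = ρ' →
        wordTrace σ ((true, true) :: (X ++ (true, false) :: Y)) =
        a * a' * wordTrace σ [] + (a * b' + a' * b) * wordTrace σ [(false, true)]
        + (a * c' + a' * c) * wordTrace σ [(false, false)]
        + b * b' * wordTrace σ [(true, true), (false, true), (true, false), (false, true)]
        + b * c' * wordTrace σ [(true, true), (false, true), (true, false), (false, false)]
        + c * b' * wordTrace σ [(true, true), (false, false), (true, false), (false, true)]
        + c * c' * wordTrace σ [(true, true), (false, false), (true, false), (false, false)] := by
      intro σ hσ
      have e : (σ true).1 * ((σ true)⁻¹).1 = 1 := by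
        rw [← Matrix.SpecialLinearGroup.coe_mul]; simp
      have e' : ∀ Z, (σ true).1 * (((σ true)⁻¹).1 * Z) = Z := by
        intro Z; rw [← Matrix.mul_assoc, e, one_mul]
      have conj : ∀ Z, ((σ true).1 * (Z * ((σ true)⁻¹).1)).trace = Z.trace := by
        intro Z
        rw [Matrix.trace_mul_comm, Matrix.mul_assoc, ← Matrix.SpecialLinearGroup.coe_mul]
        simp
      simp only [wordTrace, word_cons, word_append, word_nil, mul_one, letter, cond_true,
        cond_false, Matrix.SpecialLinearGroup.coe_mul, h σ hσ, h' σ hσ, mul_add, add_mul,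
        mul_smul_comm, smul_mul_assoc, Matrix.trace_add, Matrix.trace_smul, smul_eq_mul, one_mul,
        e, e', conj, Matrix.SpecialLinearGroup.coe_one]
      ring
    rw [expand ρ (Or.inl rfl), expand ρ' (Or.inr rfl), h1, k1, k2, k3, k4, k5, k6]
  -- strong induction on the number of occurrences of the first generator
  induction hn : L.countP (·.1) using Nat.strong_induction_on generalizing L with
  | _ n ih =>
  subst hn
  have red : ∀ (i : Bool) (X Y : List (Bool × Bool)),
      X.countP (·.1) + Y.countP (·.1) + 2 = L.countP (·.1) →
      wordTrace ρ ((true, i) :: (X ++ (true, i) :: Y)) =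
        wordTrace ρ' ((true, i) :: (X ++ (true, i) :: Y)) := by
    intro i X Y hc
    have key : ∀ Z : List (Bool × Bool), Z.countP (·.1) < L.countP (·.1) →
      wordTrace ρ Z = wordTrace ρ' Z := fun Z hZ => ih _ hZ Z rfl
    rw [wordTrace_repeat, wordTrace_repeat]
    rw [key ((true, !i) :: (X ++ Y)), key ((true, !i) :: (Y ++ X)), key [(true, !i)],
      key (X ++ Y), key X, key Y, key ((true, !i) :: Y), key ((true, i) :: X),
      key ((true, i) :: Y), key ((true, !i) :: X)]
    all_goals try simp
    all_goals omega
  have rotate : ∀ P Q : List (Bool × Bool), wordTrace ρ (Q ++ P) = wordTrace ρ' (Q ++ P) →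
      wordTrace ρ (P ++ Q) = wordTrace ρ' (P ++ Q) := by
    intro P Q h
    rw [wordTrace_append_comm, h, wordTrace_append_comm]
  have only : ∀ X : List (Bool × Bool), (true, true) ∉ X → (true, false) ∉ X →
      ∀ y ∈ X, y.1 = false := by
    rintro X h h' ⟨_ | _, _ | _⟩ hy
    · rfl
    · rfl
    · exact absurd hy h'
    · exact absurd hy h
  -- Up to rotation, two occurrences of the first generator with equal sign can be reduced by `red`.
  -- What survives has at most one occurrence, or exactly one of each sign.
  by_cases htt : (true, true) ∈ L
  · obtain ⟨P, Q, rfl⟩ := List.append_of_mem htt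
    apply rotate
    rw [List.cons_append]
    by_cases h : (true, true) ∈ Q ++ P
    · obtain ⟨X, Y, hXY⟩ := List.append_of_mem h
      rw [hXY]
      apply red
      have := congrArg (List.countP (·.1)) hXY
      simp at this ⊢
      omega
    by_cases h' : (true, false) ∈ Q ++ P
    · obtain ⟨X, Y, hXY⟩ := List.append_of_mem h'
      have hc := congrArg (List.countP (·.1)) hXY
      rw [hXY] at h ⊢
      by_cases hX : (true, false) ∈ Y ++ (true, true) :: X
      · have := rotate ((true, true) :: X) ((true, false) :: Y)
        apply this
        rw [List.cons_append]
        obtain ⟨Z, W, hZW⟩ := List.append_of_mem hX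
        rw [hZW]
        apply red
        have := congrArg (List.countP (·.1)) hZW
        simp at this hc ⊢
        omega
      · simp only [List.mem_append, List.mem_cons, not_or] at h hX
        exact base2 X Y (only _ h.1 hX.2.2) (only _ h.2.2 hX.1)
    · exact base1 _ _ (only _ h h')
  by_cases htf : (true, false) ∈ L
  · obtain ⟨P, Q, rfl⟩ := List.append_of_mem htf
    apply rotate
    rw [List.cons_append]
    have h : (true, true) ∉ Q ++ P := by
      simp only [List.mem_append, List.mem_cons, not_or] at htt ⊢
      exact ⟨htt.2.2, htt.1⟩
    by_cases h' : (true, false) ∈ Q ++ P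
    · obtain ⟨X, Y, hXY⟩ := List.append_of_mem h'
      rw [hXY]
      apply red
      have := congrArg (List.countP (·.1)) hXY
      simp at this ⊢
      omega
    · exact base1 _ _ (only _ h h')
  · exact base0 _ (only _ htt htf)

end WordTraces

/-! ### Burnside's theorem -/

section Burnside

/-- **Burnside's theorem**: a subalgebra of `End V` acting irreducibly on a finite-dimensional
space over an algebraically closed field is everything. -/
theorem subalgebra_eq_top_of_irreducible {k V : Type*} [Field k] [IsAlgClosed k] [AddCommGroup V]
    [Module k V] [FiniteDimensional k V] [Nontrivial V] (S : Subalgebra k (Module.End k V))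
    (hS : ∀ W : Submodule k V, (∀ f ∈ S, ∀ v ∈ W, f v ∈ W) → W = ⊥ ∨ W = ⊤) : S = ⊤ := by
  have hsimple : IsSimpleModule S V := by
    rw [isSimpleModule_iff]
    refine { eq_bot_or_eq_top := fun W => ?_ }
    refine (hS (W.restrictScalars k) fun f hf v hv => W.smul_mem ⟨f, hf⟩ hv).imp ?_ ?_ <;>
    · intro h
      apply SetLike.coe_injective
      exact congrArg (SetLike.coe : Submodule k V → Set V) h
  -- Schur's lemma: the commutant of `S` consists of scalars, so every `k`-linear map is linear over
  -- it, and the density theorem puts that map in `S`.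
  have hend := (IsSimpleModule.algebraMap_end_bijective_of_isAlgClosed (A := S) (V := V) k).2
  have : Module.Finite (Module.End S V) V := by
    have : IsScalarTower k (Module.End S V) V := ⟨fun a f v => by simp⟩
    exact Module.Finite.of_restrictScalars_finite k _ _
  refine eq_top_iff.2 fun f _ => ?_
  let F : Module.End (Module.End S V) V :=
    { toFun := f
      map_add' := map_add f
      map_smul' := fun c v => by
        obtain ⟨a, rfl⟩ := hend c
        simp }
  obtain ⟨s, hs⟩ := Module.Finite.toModuleEnd_moduleEnd_surjective (R := S) (M := V) F
  have : s.1 = f := by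
    ext v
    exact congrArg (fun g => g v) hs
  exact this ▸ s.2

/-- The matrices of an irreducible group of matrices span the full matrix algebra. -/
theorem span_range_eq_top_of_irreducible {k G n : Type*} [Field k] [IsAlgClosed k] [Monoid G]
    [Fintype n] [DecidableEq n] [Nonempty n] (ρ : G →* Matrix n n k)
    (h : ∀ W : Submodule k (n → k), (∀ g, ∀ v ∈ W, ρ g *ᵥ v ∈ W) → W = ⊥ ∨ W = ⊤) :
    Submodule.span k (Set.range ρ) = ⊤ := by
  -- The image is already a submonoid, so the algebra it generates is just its linear span.
  have hclos : (Submonoid.closure (Set.range ρ) : Set (Matrix n n k)) = Set.range ρ := by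
    rw [← MonoidHom.coe_mrange, Submonoid.closure_eq]
  have hadj : Algebra.adjoin k (Set.range ρ) = ⊤ := by
    have key : (Algebra.adjoin k (Set.range ρ)).map
        (Matrix.toLinAlgEquiv' (R := k) (n := n)).toAlgHom = ⊤ := by
      apply subalgebra_eq_top_of_irreducible
      intro W hW
      refine h W fun g v hv => ?_
      have := hW (Matrix.toLinAlgEquiv' (ρ g))
        ⟨ρ g, Algebra.subset_adjoin ⟨g, rfl⟩, rfl⟩ v hv
      simpa using this
    rw [eq_top_iff]
    intro M _
    have : Matrix.toLinAlgEquiv' M ∈ (Algebra.adjoin k (Set.range ρ)).map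
        (Matrix.toLinAlgEquiv' (R := k) (n := n)).toAlgHom := key ▸ Algebra.mem_top
    obtain ⟨N, hN, hNM⟩ := this
    have : N = M := Matrix.toLinAlgEquiv'.injective hNM
    exact this ▸ hN
  have := Algebra.adjoin_eq_span k (Set.range ρ)
  rw [hclos, hadj] at this
  exact this.symm

end Burnside

/-! ### Representations determined by their characters -/

section Characters

variable {k G n : Type*} [Field k] [Group G] [Fintype n] [DecidableEq n]

theorem lift_surjective_of_span_eq_top (ρ : G →* Matrix n n k)
    (h : Submodule.span k (Set.range ρ) = ⊤) :
    Function.Surjective (MonoidAlgebra.lift k (Matrix n n k) G ρ) := by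
  intro M
  have hM : M ∈ Submodule.span k (Set.range ρ) := h ▸ Submodule.mem_top
  induction hM using Submodule.span_induction with
  | mem M hM =>
    obtain ⟨g, rfl⟩ := hM
    exact ⟨MonoidAlgebra.single g 1, by simp⟩
  | zero => exact ⟨0, map_zero _⟩
  | add M N _ _ hM hN =>
    obtain ⟨x, rfl⟩ := hM
    obtain ⟨y, rfl⟩ := hN
    exact ⟨x + y, map_add _ _ _⟩
  | smul a M _ hM =>
    obtain ⟨x, rfl⟩ := hM
    exact ⟨a • x, map_smul _ _ _⟩

theorem trace_lift_eq (ρ ρ' : G →* Matrix n n k) (h : ∀ g, (ρ g).trace = (ρ' g).trace)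
    (x : MonoidAlgebra k G) :
    (MonoidAlgebra.lift k (Matrix n n k) G ρ x).trace =
      (MonoidAlgebra.lift k (Matrix n n k) G ρ' x).trace := by
  induction x using MonoidAlgebra.induction_on with
  | of g => simp [h]
  | add x y hx hy => simp [hx, hy]
  | smul r x hx => simp [hx]

/-- If `ρ` kills `x`, then `tr (ρ' x * ρ' y) = tr (ρ (x * y)) = 0` for all `y`. The `ρ' y` fill the
matrix algebra, whose trace form is nondegenerate. -/
theorem lift_eq_zero_of_lift_eq_zero (ρ ρ' : G →* Matrix n n k)
    (h : ∀ g, (ρ g).trace = (ρ' g).trace) (hρ' : Submodule.span k (Set.range ρ') = ⊤)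
    (x : MonoidAlgebra k G) (hx : MonoidAlgebra.lift k (Matrix n n k) G ρ x = 0) :
    MonoidAlgebra.lift k (Matrix n n k) G ρ' x = 0 := by
  rw [Matrix.ext_iff_trace_mul_right]
  intro M
  obtain ⟨y, rfl⟩ := lift_surjective_of_span_eq_top ρ' hρ' M
  rw [← map_mul, ← trace_lift_eq ρ ρ' h, map_mul, hx, zero_mul, zero_mul]

/-- Two matrix representations with the same character, both spanning the matrix algebra, are
conjugate. -/
theorem exists_conj_of_trace_eq (ρ ρ' : G →* Matrix n n k)
    (h : ∀ g, (ρ g).trace = (ρ' g).trace) (hρ : Submodule.span k (Set.range ρ) = ⊤)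
    (hρ' : Submodule.span k (Set.range ρ') = ⊤) :
    ∃ S : Matrix n n k, IsUnit S.det ∧ ∀ g, ρ' g * S = S * ρ g := by
  set f := MonoidAlgebra.lift k (Matrix n n k) G ρ with hf
  set f' := MonoidAlgebra.lift k (Matrix n n k) G ρ' with hf'
  have surj := lift_surjective_of_span_eq_top ρ hρ
  have surj' := lift_surjective_of_span_eq_top ρ' hρ'
  have ker : ∀ x, f x = 0 → f' x = 0 := lift_eq_zero_of_lift_eq_zero ρ ρ' h hρ'
  have ker' : ∀ x, f' x = 0 → f x = 0 :=
    lift_eq_zero_of_lift_eq_zero ρ' ρ (fun g => (h g).symm) hρ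
  have congr : ∀ x y, f x = f y → f' x = f' y := fun x y hxy => by
    rw [← sub_eq_zero, ← map_sub]
    exact ker _ (by rw [map_sub, hxy, sub_self])
  -- Equal kernels make `f x ↦ f' x` a well-defined algebra automorphism; it is built from a
  -- set-theoretic section of `f`.
  let r := Function.surjInv surj
  have hr : ∀ M, f (r M) = M := Function.surjInv_eq surj
  let L : Matrix n n k →ₗ[k] Matrix n n k :=
    { toFun := fun M => f' (r M)
      map_add' := fun M N => by
        rw [← map_add]
        exact congr _ _ (by simp only [hr, map_add])
      map_smul' := fun a M => by
        rw [RingHom.id_apply, ← map_smul]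
        exact congr _ _ (by simp only [hr, map_smul]) }
  let φ : Matrix n n k →ₐ[k] Matrix n n k := AlgHom.ofLinearMap L
    ((congr _ 1 (by simp only [hr, map_one])).trans (map_one f'))
    (fun M N => (congr _ (r M * r N) (by simp only [hr, map_mul])).trans (map_mul f' _ _))
  have hφ : ∀ x, φ (f x) = f' x := fun x => congr _ _ (hr _)
  have bij : Function.Bijective φ := by
    constructor
    · rw [injective_iff_map_eq_zero]
      intro M hM
      rw [← hr M]
      exact ker' _ hM
    · intro M
      obtain ⟨x, rfl⟩ := surj' M
      exact ⟨f x, hφ x⟩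
  -- Skolem–Noether: an automorphism of the endomorphism algebra is conjugation by some `T`.
  obtain ⟨T, hT⟩ := ((Matrix.toLinAlgEquiv'.symm.trans (AlgEquiv.ofBijective φ bij)).trans
    (Matrix.toLinAlgEquiv' (R := k) (n := n))).eq_linearEquivConjAlgEquiv
  refine ⟨LinearMap.toMatrix' (T : (n → k) →ₗ[k] (n → k)), ?_, fun g => ?_⟩
  · rw [LinearMap.det_toMatrix']
    exact LinearEquiv.isUnit_det' T
  · have h1 := congrArg (fun e => e (Matrix.toLinAlgEquiv' (ρ g))) hT
    have h2 : φ (ρ g) = ρ' g := by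
      have := hφ (MonoidAlgebra.single g 1)
      simpa [hf, hf'] using this
    simp only [AlgEquiv.trans_apply, AlgEquiv.symm_apply_apply, AlgEquiv.coe_ofBijective, h2,
      LinearEquiv.conjAlgEquiv_apply] at h1
    apply Matrix.toLin'.injective
    rw [Matrix.toLin'_mul, Matrix.toLin'_mul, Matrix.toLin'_toMatrix']
    refine LinearMap.ext fun v => ?_
    have h3 := congrArg (fun e => e (T v)) h1
    simpa using h3

end Characters

/-! ### Congruence of symmetric forms -/

section SymmetricForms

/-- Two nondegenerate symmetric matrices over an algebraically closed field of characteristic not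
two are congruent. -/
theorem exists_transpose_mul_mul_eq {K n : Type*} [Field K] [IsAlgClosed K] [Invertible (2 : K)]
    [Fintype n] [DecidableEq n] (S J : Matrix n n K) (hS : Sᵀ = S) (hJ : Jᵀ = J)
    (hS' : S.det ≠ 0) (hJ' : J.det ≠ 0) : ∃ P : Matrix n n K, Pᵀ * J * P = S := by
  let Q : Matrix n n K → QuadraticForm K (n → K) := fun M =>
    LinearMap.BilinMap.toQuadraticMap (Matrix.toLinearMap₂' K M : LinearMap.BilinForm K (n → K))
  have assoc : ∀ M : Matrix n n K, Mᵀ = M →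
      QuadraticMap.associated (R := K) (Q M) =
        Matrix.toLinearMap₂' K M := by
    intro M hM
    apply QuadraticMap.associated_left_inverse
    intro x y
    simp only [Matrix.toLinearMap₂'_apply']
    rw [Matrix.dotProduct_mulVec, ← Matrix.mulVec_transpose, hM, dotProduct_comm]
  obtain ⟨e⟩ := QuadraticForm.equivalent_of_isAlgClosed
    (Q S) (Q J)
    (by rw [assoc S hS]; exact LinearMap.separatingLeft_toLinearMap₂'_iff_det_ne_zero.2 hS')
    (by rw [assoc J hJ]; exact LinearMap.separatingLeft_toLinearMap₂'_iff_det_ne_zero.2 hJ')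
  let P := LinearMap.toMatrix' (e.toLinearEquiv : (n → K) →ₗ[K] (n → K))
  suffices h : (Matrix.toLinearMap₂' K (Pᵀ * J * P) : LinearMap.BilinForm K (n → K)) =
      Matrix.toLinearMap₂' K S from
    ⟨P, (Matrix.toLinearMap₂' K).injective h⟩
  rw [← assoc S hS, ← assoc (Pᵀ * J * P) (by
    simp only [Matrix.transpose_mul, Matrix.transpose_transpose, hJ, Matrix.mul_assoc])]
  refine congrArg (QuadraticMap.associated (R := K)) (QuadraticMap.ext fun x => ?_)
  rw [← e.map_app x]
  have hP : P *ᵥ x = e x := by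
    rw [← Matrix.toLin'_apply, Matrix.toLin'_toMatrix']; rfl
  simp only [Q, LinearMap.BilinMap.toQuadraticMap_apply, Matrix.toLinearMap₂'_apply']
  rw [← hP, Matrix.mul_assoc, ← Matrix.mulVec_mulVec, ← Matrix.mulVec_mulVec,
    Matrix.dotProduct_mulVec, ← Matrix.mulVec_transpose, Matrix.transpose_transpose]

end SymmetricForms

/-! ### The image of `Φ_*` as a special orthogonal group -/

section OrthogonalGroup

/-- The matrix of the quadratic form `y² + 2xz`, which is preserved by the image of `Φ_*`. -/
def formMatrix : Matrix (Fin 3) (Fin 3) ℂ :=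
  !![0, 0, 1; 0, 1, 0; 1, 0, 0]

theorem formMatrix_det : formMatrix.det = -1 := by
  simp [formMatrix, Matrix.det_fin_three]

theorem formMatrix_transpose : formMatrixᵀ = formMatrix := by
  ext i j
  fin_cases i <;> fin_cases j <;> rfl

theorem phiStar_coe (N : SL(2, ℂ)) : (phiStar N).1 = phiStarMatrix N.1 := rfl

theorem phiStar_preserves_form (N : SL(2, ℂ)) :
    (phiStar N).1ᵀ * formMatrix * (phiStar N).1 = formMatrix := by
  have hd := N.det_coe
  rw [Matrix.det_fin_two] at hd
  have hs := sqrt_two_mul_self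
  ext i j
  fin_cases i <;> fin_cases j <;>
    simp [phiStar_coe, phiStarMatrix, formMatrix, Matrix.mul_apply, Fin.sum_univ_succ] <;>
    generalize ((Real.sqrt 2 : ℝ) : ℂ) = s at * <;>
    grind

/-- The isotropic vectors are exactly the possible first columns of `phiStarMatrix`: take a square
root of `p`, solve for `c`, and `r` is then forced. -/
theorem exists_isotropic_parametrization (p q r : ℂ) (h : q ^ 2 + 2 * p * r = 0) :
    ∃ a c : ℂ, p = a ^ 2 ∧ q = -((Real.sqrt 2 : ℝ) : ℂ) * a * c ∧ r = -c ^ 2 := by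
  have hs := sqrt_two_mul_self
  generalize ((Real.sqrt 2 : ℝ) : ℂ) = s at *
  have hs0 : s ≠ 0 := by rintro rfl; simp at hs
  by_cases hp : p = 0
  · subst hp
    have hq : q = 0 := by simpa using h
    obtain ⟨c, hc⟩ := IsAlgClosed.exists_eq_mul_self (-r)
    exact ⟨0, c, by simp, by simp [hq], by rw [sq, ← hc, neg_neg]⟩
  · obtain ⟨a, ha⟩ := IsAlgClosed.exists_eq_mul_self p
    have ha0 : a ≠ 0 := by rintro rfl; simp at ha; exact hp ha
    refine ⟨a, -q / (s * a), by rw [ha, sq], by field_simp, ?_⟩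
    have : (s * a) ^ 2 = 2 * p := by rw [ha]; linear_combination a ^ 2 * hs
    rw [div_pow, this]
    field_simp
    linear_combination h

/-- An element of `SL(3, ℂ)` preserving the form `y² + 2xz` and fixing the first basis vector is in
the image of the upper unipotent subgroup. -/
theorem mem_range_phiStar_of_fixes (M : SL(3, ℂ))
    (hM : M.1ᵀ * formMatrix * M.1 = formMatrix) (h0 : M.1 0 0 = 1) (h1 : M.1 1 0 = 0)
    (h2 : M.1 2 0 = 0) : M ∈ phiStar.range := by
  have hs := sqrt_two_mul_self
  have hdet := M.det_coe
  rw [Matrix.det_fin_three] at hdet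
  have e := fun i j => congrFun (congrFun hM i) j
  have e01 := e 0 1
  have e02 := e 0 2
  have e12 := e 1 2
  have e22 := e 2 2
  -- Invariance gives `M 2 1 = 0` and `M 2 2 = 1`; the determinant then gives `M 1 1 = 1`, excluding
  -- the value `-1` that the form alone would allow.
  simp [formMatrix, Matrix.mul_apply, Fin.sum_univ_succ, h0, h1, h2] at e01 e02 e12 e22
  simp [h0, h1, h2, e01, e02] at hdet
  simp [e01, e02, hdet] at e12 e22
  -- The `(0, 1)` entry of `Φ_*` at this unipotent is `-√2 b`, whence `b = -(√2 / 2) * M 0 1`.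
  refine MonoidHom.mem_range.2 ⟨⟨!![1, -((Real.sqrt 2 : ℝ) : ℂ) / 2 * M.1 0 1; 0, 1], by simp [Matrix.det_fin_two]⟩, ?_⟩
  apply Subtype.ext
  change phiStarMatrix !![1, -((Real.sqrt 2 : ℝ) : ℂ) / 2 * M.1 0 1; 0, 1] = M.1
  ext i j
  fin_cases i <;> fin_cases j <;>
    simp [phiStarMatrix, h0, h1, h2, e01, e02, hdet] <;>
    generalize ((Real.sqrt 2 : ℝ) : ℂ) = s at * <;>
    grind

/-- The first column of `M` is a nonzero isotropic vector, hence the first column of some `phiStar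
N`. Dividing by `phiStar N` leaves an element that fixes the first basis vector. -/
theorem mem_range_phiStar_of_preserves_form (M : SL(3, ℂ))
    (hM : M.1ᵀ * formMatrix * M.1 = formMatrix) : M ∈ phiStar.range := by
  have e00 := congrFun (congrFun hM 0) 0
  simp [formMatrix, Matrix.mul_apply, Fin.sum_univ_succ] at e00
  obtain ⟨a, c, ha, hac, hc⟩ := exists_isotropic_parametrization (M.1 0 0) (M.1 1 0) (M.1 2 0)
    (by linear_combination e00)
  have hne : ∃ b d : ℂ, a * d - b * c = 1 := by
    by_cases ha0 : a = 0
    · have hc0 : c ≠ 0 := by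
        rintro rfl
        have hdet := M.det_coe
        rw [Matrix.det_fin_three] at hdet
        simp [ha, hac, hc, ha0] at hdet
      exact ⟨-1 / c, 0, by field_simp; simp⟩
    · exact ⟨0, 1 / a, by field_simp; simp⟩
  obtain ⟨b, d, hbd⟩ := hne
  let N : SL(2, ℂ) := ⟨!![a, b; c, d], by simpa [Matrix.det_fin_two] using hbd⟩
  have hcol : ∀ i, (phiStar N).1 i 0 = M.1 i 0 := by
    intro i
    change phiStarMatrix !![a, b; c, d] i 0 = M.1 i 0
    fin_cases i <;> simp [phiStarMatrix, ha, hac, hc]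
  have hcol' : ∀ i, ((phiStar N)⁻¹ * M).1 i 0 = (1 : Matrix (Fin 3) (Fin 3) ℂ) i 0 := by
    intro i
    have : ((phiStar N)⁻¹ * phiStar N).1 i 0 = (1 : Matrix (Fin 3) (Fin 3) ℂ) i 0 := by
      rw [inv_mul_cancel]; rfl
    rw [← this, Matrix.SpecialLinearGroup.coe_mul, Matrix.SpecialLinearGroup.coe_mul,
      Matrix.mul_apply, Matrix.mul_apply]
    simp only [hcol]
  have key : (phiStar N)⁻¹ * M ∈ phiStar.range := by
    apply mem_range_phiStar_of_fixes
    · have h := phiStar_preserves_form N⁻¹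
      rw [map_inv] at h
      rw [Matrix.SpecialLinearGroup.coe_mul, Matrix.transpose_mul]
      calc _ = M.1ᵀ * (((phiStar N)⁻¹).1ᵀ * formMatrix * ((phiStar N)⁻¹).1) * M.1 := by
            simp only [Matrix.mul_assoc]
        _ = formMatrix := by rw [h, hM]
    · simpa using hcol' 0
    · simpa using hcol' 1
    · simpa using hcol' 2
  have := mul_mem (⟨N, rfl⟩ : phiStar N ∈ phiStar.range) key
  simpa using this

/-- A subgroup of `SL(3, ℂ)` preserving a nondegenerate symmetric form is conjugate into the image
of `Φ_*`. -/
theorem exists_conj_mem_range_phiStar (S : Matrix (Fin 3) (Fin 3) ℂ) (hS : Sᵀ = S)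
    (hdet : S.det ≠ 0) :
    ∃ D : SL(3, ℂ), ∀ g : SL(3, ℂ), g.1ᵀ * S * g.1 = S → D * g * D⁻¹ ∈ phiStar.range := by
  obtain ⟨P, hP⟩ := exists_transpose_mul_mul_eq S formMatrix hS formMatrix_transpose hdet
    (by rw [formMatrix_det]; norm_num)
  have hPdet : P.det ≠ 0 := by
    intro h
    rw [← hP, Matrix.det_mul, h, mul_zero] at hdet
    exact hdet rfl
  -- Dividing by a cube root of the determinant puts `P` in `SL(3, ℂ)` and only rescales the form,
  -- which has the same stabiliser.
  obtain ⟨l, hl⟩ := IsAlgClosed.exists_pow_nat_eq P.det (n := 3) (by norm_num)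
  have hl0 : l ≠ 0 := by
    rintro rfl
    exact hPdet (by rw [← hl]; norm_num)
  let D : SL(3, ℂ) := ⟨l⁻¹ • P, by
    rw [Matrix.det_smul, Fintype.card_fin, ← hl]
    field_simp⟩
  have hD : D.1ᵀ * formMatrix * D.1 = (l⁻¹ * l⁻¹) • S := by
    simp only [D, Matrix.transpose_smul, Matrix.smul_mul, Matrix.mul_smul, hP, smul_smul]
  refine ⟨D, fun g hg => mem_range_phiStar_of_preserves_form _ ?_⟩
  have h₁ : (D⁻¹).1ᵀ * D.1ᵀ = 1 := by
    rw [← Matrix.transpose_mul, ← Matrix.SpecialLinearGroup.coe_mul, mul_inv_cancel]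
    simp
  have h₂ : D.1 * (D⁻¹).1 = 1 := by
    rw [← Matrix.SpecialLinearGroup.coe_mul, mul_inv_cancel]
    simp
  simp only [Matrix.SpecialLinearGroup.coe_mul, Matrix.transpose_mul]
  calc _ = (D⁻¹).1ᵀ * (g.1ᵀ * (D.1ᵀ * formMatrix * D.1) * g.1) * (D⁻¹).1 := by
        simp only [Matrix.mul_assoc]
    _ = (D⁻¹).1ᵀ * (D.1ᵀ * formMatrix * D.1) * (D⁻¹).1 := by
        rw [hD, Matrix.mul_smul, Matrix.smul_mul, hg]
    _ = ((D⁻¹).1ᵀ * D.1ᵀ) * formMatrix * (D.1 * (D⁻¹).1) := by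
        simp only [Matrix.mul_assoc]
    _ = formMatrix := by rw [h₁, h₂, one_mul, mul_one]

end OrthogonalGroup

/-! ### The invariant symmetric form -/

section InvariantForm

/-- The contragredient automorphism `g ↦ (g⁻¹)ᵀ`. -/
def contragredient {n R : Type*} [Fintype n] [DecidableEq n] [CommRing R] :
    Matrix.SpecialLinearGroup n R →* Matrix.SpecialLinearGroup n R where
  toFun g := (g⁻¹).transpose
  map_one' := by
    apply Subtype.ext
    simp
  map_mul' g h := by
    apply Subtype.ext
    rw [mul_inv_rev]
    exact Matrix.transpose_mul _ _

theorem contragredient_coe {n R : Type*} [Fintype n] [DecidableEq n] [CommRing R]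
    (g : Matrix.SpecialLinearGroup n R) : (contragredient g).1 = (g⁻¹).1ᵀ := rfl

/-- An irreducible representation in `SL(3, k)` whose character is invariant under inversion
preserves a nondegenerate symmetric form. -/
theorem exists_invariant_symmetric_form {k G : Type*} [Field k] [IsAlgClosed k] [Group G]
    (F : G →* Matrix.SpecialLinearGroup (Fin 3) k)
    (hirr : ∀ W : Submodule k (Fin 3 → k), (∀ g, ∀ v ∈ W, (F g).1 *ᵥ v ∈ W) → W = ⊥ ∨ W = ⊤)
    (htr : ∀ g, (F g).1.trace = (F g)⁻¹.1.trace) :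
    ∃ S : Matrix (Fin 3) (Fin 3) k, Sᵀ = S ∧ S.det ≠ 0 ∧
      ∀ g, (F g).1ᵀ * S * (F g).1 = S := by
  let ρ : G →* Matrix (Fin 3) (Fin 3) k := Matrix.SpecialLinearGroup.coeMonoidHom.comp F
  let ρ' : G →* Matrix (Fin 3) (Fin 3) k :=
    Matrix.SpecialLinearGroup.coeMonoidHom.comp (contragredient.comp F)
  have hρ : ∀ g, ρ g = (F g).1 := fun _ => rfl
  have hρ' : ∀ g, ρ' g = (F g)⁻¹.1ᵀ := fun _ => rfl
  have hspan : Submodule.span k (Set.range ρ) = ⊤ := span_range_eq_top_of_irreducible ρ hirr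
  have hspan' : Submodule.span k (Set.range ρ') = ⊤ := by
    have himage : Set.range ρ' =
        (Matrix.transposeLinearEquiv (Fin 3) (Fin 3) k k : _ →ₗ[k] _) '' Set.range ρ := by
      ext M
      constructor
      · rintro ⟨g, rfl⟩
        exact ⟨_, ⟨g⁻¹, rfl⟩, by rw [hρ, hρ', map_inv]; rfl⟩
      · rintro ⟨_, ⟨g, rfl⟩, rfl⟩
        exact ⟨g⁻¹, by rw [hρ, hρ', map_inv, inv_inv]; rfl⟩
    rw [himage, Submodule.span_image, hspan, Submodule.map_top]
    exact LinearEquiv.range _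
  obtain ⟨S, hS, hconj⟩ := exists_conj_of_trace_eq ρ ρ'
    (fun g => by rw [hρ, hρ', Matrix.trace_transpose, htr]) hspan hspan'
  -- The intertwining relation `g⁻ᵀ S = S g` is invariance of the form `S`.
  have hinv : ∀ g, (F g).1ᵀ * S * (F g).1 = S := by
    intro g
    rw [Matrix.mul_assoc, ← hρ, ← hconj, hρ', ← Matrix.mul_assoc, hρ, ← Matrix.transpose_mul,
      ← Matrix.SpecialLinearGroup.coe_mul, inv_mul_cancel]
    simp
  have hdet : S.det ≠ 0 := hS.ne_zero
  refine ⟨S, ?_, hdet, hinv⟩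
  -- `S⁻¹ Sᵀ` commutes with the whole matrix algebra
  have hcommρ : ∀ g, Commute (ρ g) (S⁻¹ * Sᵀ) := by
    intro g
    have h2 : (F g).1ᵀ * Sᵀ * (F g).1 = Sᵀ := by
      have := congrArg Matrix.transpose (hinv g)
      simpa [Matrix.transpose_mul, Matrix.mul_assoc] using this
    have hu : (F g).1ᵀ * (F g)⁻¹.1ᵀ = 1 := by
      rw [← Matrix.transpose_mul, ← Matrix.SpecialLinearGroup.coe_mul, inv_mul_cancel]
      simp
    have hu' : (F g)⁻¹.1ᵀ * (F g).1ᵀ = 1 := mul_eq_one_comm.1 hu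
    have h3 : Sᵀ * (F g).1 = (F g)⁻¹.1ᵀ * Sᵀ := by
      rw [← one_mul (Sᵀ * (F g).1), ← hu', Matrix.mul_assoc, ← Matrix.mul_assoc _ Sᵀ, h2]
    have h4 := hconj g
    rw [hρ, hρ'] at h4
    change (F g).1 * (S⁻¹ * Sᵀ) = S⁻¹ * Sᵀ * (F g).1
    rw [Matrix.mul_assoc, h3, ← Matrix.mul_assoc S⁻¹]
    have h5 : S⁻¹ * (F g)⁻¹.1ᵀ = (F g).1 * S⁻¹ := by
      have : S⁻¹ * ((F g)⁻¹.1ᵀ * S) * S⁻¹ = S⁻¹ * (S * (F g).1) * S⁻¹ := by rw [h4]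
      rwa [← Matrix.mul_assoc, Matrix.mul_nonsing_inv_cancel_right _ _ hS,
        Matrix.nonsing_inv_mul_cancel_left _ _ hS] at this
    rw [h5, Matrix.mul_assoc]
  have hcomm : ∀ M : Matrix (Fin 3) (Fin 3) k, Commute M (S⁻¹ * Sᵀ) := by
    intro M
    have hM : M ∈ Submodule.span k (Set.range ρ) := hspan ▸ Submodule.mem_top
    induction hM using Submodule.span_induction with
    | mem M hM =>
      obtain ⟨g, rfl⟩ := hM
      exact hcommρ g
    | zero => exact Commute.zero_left _
    | add M N _ _ hM hN => exact hM.add_left hN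
    | smul a M _ hM => exact hM.smul_left a
  obtain ⟨c, hc⟩ := Matrix.mem_range_scalar_of_commute_single
    (M := S⁻¹ * Sᵀ) fun i j _ => hcomm _
  have hSc : Sᵀ = c • S := by
    have : S * (S⁻¹ * Sᵀ) = S * Matrix.scalar (Fin 3) c := by rw [hc]
    rw [Matrix.mul_nonsing_inv_cancel_left _ _ hS] at this
    rw [this, Matrix.scalar_apply, ← Matrix.smul_one_eq_diagonal, Matrix.mul_smul, mul_one]
  have h2 : c ^ 2 = 1 := by
    have h := congrArg Matrix.transpose hSc
    rw [Matrix.transpose_transpose, Matrix.transpose_smul, hSc, smul_smul] at h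
    have hne : S ≠ 0 := by
      rintro rfl
      simp at hdet
    have h' : (1 - c * c) • S = 0 := by rw [sub_smul, one_smul, ← h, sub_self]
    rcases smul_eq_zero.1 h' with h' | h'
    · linear_combination -h'
    · exact absurd h' hne
  -- The exponent is the dimension; its being odd rules out `c = -1`, the alternating case.
  have h3 : c ^ 3 = 1 := by
    have h := congrArg Matrix.det hSc
    rw [Matrix.det_transpose, Matrix.det_smul, Fintype.card_fin] at h
    exact mul_right_cancel₀ hdet (by rw [one_mul, ← h])
  have h1 : c = 1 := by linear_combination h3 - c * h2
  rw [hSc, h1, one_smul]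

end InvariantForm

/-! ### Invariance of the character under inversion -/

theorem word_contragredient (ρ : Bool → SL(3, ℂ)) (L : List (Bool × Bool)) :
    word (fun i => contragredient (ρ i)) L = contragredient (word ρ L) := by
  rw [word, word, map_list_prod, List.map_map]
  congr 2
  funext x
  rcases x with ⟨i, _ | _⟩ <;> simp [letter]

theorem wordTrace_contragredient (ρ : Bool → SL(3, ℂ)) (L : List (Bool × Bool)) :
    wordTrace (fun i => contragredient (ρ i)) L = tr (word ρ L)⁻¹ := by
  rw [wordTrace, word_contragredient, contragredient_coe, Matrix.trace_transpose, tr]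

theorem tr_mul_comm (X Y : SL(3, ℂ)) : tr (X * Y) = tr (Y * X) := by
  simp only [tr, Matrix.SpecialLinearGroup.coe_mul]
  exact Matrix.trace_mul_comm _ _

/-- If the nine traces generating the character ring of pairs in `SL(3, ℂ)`, together with that of
the inverse commutator, are invariant under inversion, then so is the whole character. -/
theorem tr_word_eq_tr_inv (A B : SL(3, ℂ)) (hA : tr A = tr A⁻¹) (hB : tr B = tr B⁻¹)
    (hAB : tr (A * B) = tr (A * B)⁻¹) (hAB' : tr (A⁻¹ * B) = tr (A⁻¹ * B)⁻¹)
    (hcomm : tr (A * B * A⁻¹ * B⁻¹) = tr (A * B * A⁻¹ * B⁻¹)⁻¹) (L : List (Bool × Bool)) :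
    tr (word (fun i => cond i A B) L) = tr (word (fun i => cond i A B) L)⁻¹ := by
  rw [← wordTrace_contragredient]
  change wordTrace _ L = _
  apply wordTrace_eq_of_ten
  · rintro (_ | _) <;> rw [wordTrace_contragredient] <;>
      simp [wordTrace, letter, ← tr.eq_1, hA, -Matrix.SpecialLinearGroup.coe_inv]
  · rintro (_ | _) <;> rw [wordTrace_contragredient] <;>
      simp [wordTrace, letter, ← tr.eq_1, hB, -Matrix.SpecialLinearGroup.coe_inv]
  · have h1 : tr (A⁻¹ * B⁻¹) = tr (A * B) := by
      rw [hAB, mul_inv_rev, tr_mul_comm]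
    have h2 : tr (A * B⁻¹) = tr (A⁻¹ * B) := by
      rw [hAB', mul_inv_rev, inv_inv, tr_mul_comm]
    rintro (_ | _) (_ | _) <;> rw [wordTrace_contragredient, wordTrace, ← tr.eq_1] <;>
      simp only [word_cons, word_nil, letter, cond_true, cond_false, mul_one, mul_inv_rev, inv_inv]
    · rw [h1, tr_mul_comm]
    · rw [← h2, tr_mul_comm]
    · rw [h2, tr_mul_comm]
    · rw [← h1, tr_mul_comm]
  · rintro (_ | _) <;> rw [wordTrace_contragredient, wordTrace, ← tr.eq_1] <;>
      simp only [word_cons, word_nil, letter, cond_true, cond_false, mul_one, mul_inv_rev, inv_inv,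
        Bool.not_true, Bool.not_false] at hcomm ⊢
    -- `A B⁻¹ A⁻¹ B` is a cyclic rotation of the inverse of `[A, B]`, so this is again the
    -- commutator hypothesis.
    · calc tr (A * (B⁻¹ * (A⁻¹ * B))) = tr (B * (A * (B⁻¹ * A⁻¹))) := by
            rw [tr_mul_comm B]
            simp only [mul_assoc]
        _ = tr (B⁻¹ * A * B * A⁻¹) := by
            rw [← hcomm, tr_mul_comm]
            simp only [mul_assoc]
    · simpa only [mul_assoc] using hcomm

end ShapeInvariants

/-! ### The main theorem -/

open ShapeInvariants in
theorem corollary5p9 (A B C : SL(3, ℂ)) (hCBA : C * B * A = 1)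
    (hA : ShapeInvariants.tr A = ShapeInvariants.tr A⁻¹)
    (hB : ShapeInvariants.tr B = ShapeInvariants.tr B⁻¹)
    (hC : ShapeInvariants.tr C = ShapeInvariants.tr C⁻¹)
    (hσ : ShapeInvariants.shapePlus A B C = ShapeInvariants.shapeMinus A B C)
    (hcomm : ShapeInvariants.tr (A * B * A⁻¹ * B⁻¹) =
      ShapeInvariants.tr (A * B * A⁻¹ * B⁻¹)⁻¹) :
    ShapeInvariants.IsReducible (Subgroup.closure {A, B, C}) ∨
      ∃ D : SL(3, ℂ), ∀ g ∈ Subgroup.closure {A, B, C},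
        D * g * D⁻¹ ∈ ShapeInvariants.phiStar.range := by
  let F : FreeGroup Bool →* SL(3, ℂ) := FreeGroup.lift fun i => cond i A B
  have hCeq : C = (B * A)⁻¹ := by
    rw [eq_inv_iff_mul_eq_one, ← mul_assoc, hCBA]
  have hle : Subgroup.closure {A, B, C} ≤ F.range := by
    have hAF : A ∈ F.range := ⟨FreeGroup.of true, by simp [F]⟩
    have hBF : B ∈ F.range := ⟨FreeGroup.of false, by simp [F]⟩
    rw [Subgroup.closure_le]
    rintro g (rfl | rfl | rfl)
    · exact hAF
    · exact hBF
    · rw [hCeq]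
      exact inv_mem (mul_mem hBF hAF)
  by_cases hred : IsReducible (Subgroup.closure {A, B, C})
  · exact Or.inl hred
  right
  have htr : ∀ x, tr (F x) = tr (F x)⁻¹ := by
    intro x
    obtain ⟨L, rfl⟩ := Quot.exists_rep x
    have hF : F (FreeGroup.mk L) = word (fun i => cond i A B) L := FreeGroup.lift_mk
    refine (congrArg tr hF).trans (Eq.trans ?_ (congrArg (fun g => tr g⁻¹) hF).symm)
    apply tr_word_eq_tr_inv A B hA hB _ _ hcomm
    · rw [tr_mul_comm A B, mul_inv_rev, tr_mul_comm B⁻¹, ← mul_inv_rev, ← hCeq, hC, hCeq, inv_inv]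
    -- By `hA` and `hB` the products of traces in the two shape invariants agree, so `hσ` reduces to
    -- `tr (A⁻¹ B) = tr (B⁻¹ A)`.
    · rw [mul_inv_rev, inv_inv]
      simp only [shapePlus, shapeMinus] at hσ
      linear_combination hσ - tr B * hA + tr A * hB
  obtain ⟨S, hS, hdet, hinv⟩ := exists_invariant_symmetric_form F (fun W hW => by
    by_contra! h
    refine hred ⟨W, h.1, h.2, fun g hg v hv => ?_⟩
    obtain ⟨x, rfl⟩ := hle hg
    exact hW x v hv) htr
  obtain ⟨D, hD⟩ := exists_conj_mem_range_phiStar S hS hdet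
  refine ⟨D, fun g hg => hD g ?_⟩
  obtain ⟨x, rfl⟩ := hle hg
  exact hinv x
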